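/- **Setting.** Let $p,n,d\ge 1$, let $\mathcal Z\subset\mathbb R^d$ be measurable, and let $\{f_\theta:\theta\in\Theta\}$, $\Theta\subset\mathbb R^p$, be probability densities on $\mathcal Z$ (with respect to Lebesgue measure) such that $f_\theta(z)>0$ for $\theta\in\Theta$, $z\in\mathcal Z$, and $\theta\mapsto f_\theta(z)$ is thrice differentiable in a neighbourhood of each point of $\Theta$. Let $r>0$, $\Theta\subset B_p(0,r)=\{\theta:\|\theta\|\le r\}$, and let $\theta^*\in\Theta$ be such that $\Theta$ contains the segment from $\theta^*$ to each of its points (for instance $\Theta$ convex). Let $z_1,\dots,z_n$ be i.i.d. with density $f_{\theta^*}$, put $M_n(\theta)=-n^{-1}\sum_{i=1}^n\log f_\theta(z_i)$, and for $\tau>0$ let $\hat\theta\in\arg\min_{\theta\in\Theta}\{M_n(\theta)+\tfrac{\tau}{2}\|\theta\|^2\}$ (almost surely). Assume that the score $\partial_\theta\log f_{\theta^*}(z_1)$ is square integrable and let $$F^*_p=\mathbb E\big[\partial_\theta\log f_{\theta^*}(z_1)\,\partial_\theta\log f_{\theta^*}(z_1)^\top\big],\qquad \hat F_{n,p}=\frac1n\sum_{i=1}^n\partial_\theta\log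 f_{\theta^*}(z_i)\,\partial_\theta\log f_{\theta^*}(z_i)^\top .$$ For $j=1,\dots,p$ let $U^j_p(\theta,z)=\partial_{\theta_j}\partial_\theta\partial_\theta^\top\log f_\theta(z)\in\mathbb R^{p\times p}$ and, for a fixed $\delta>0$, define in $[0,\infty]$ $$\beta_p^j=\sup_{z\in\mathcal Z}\sup_{\theta\in\Theta}\|U_p^j(\theta,z)\|_{op},\qquad \alpha_p^j=\sup_{z\in\mathcal Z}\ \sup_{\theta\ne\theta'\in\Theta,\ \|\theta-\theta'\|<\delta}\frac{\|U^j_p(\theta,z)-U^j_p(\theta',z)\|_{op}}{\|\theta-\theta'\|}.$$ Let $R\in\mathbb R^p$ be the Taylor residual of $\partial_\theta M_n$ at $\theta^*$, that is, either the exact remainder $R=\partial_\theta M_n(\hat\theta)-\partial_\theta M_n(\theta^*)-\partial_\theta\partial_\theta^\top M_n(\theta^*)(\hat\theta-\theta^*)$, or any vector with $R_j=(\hat\theta-\theta^*)^\top\,\partial_\theta\partial_\theta^\top\partial_{\theta_j}M_n(\check\theta^j)\,(\hat\theta-\theta^*)$ for some $\check\theta^j\in\Theta$ whose coordinates lie between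 those of $\hat\theta$ and $\theta^*$. Put $V_2=(\hat F_{n,p}+\tau I_p)^{-1}R$ and $\|b\|_A^2=b^\top A b$. **Proposition (Taylor residual bound).** There are an absolute constant $C>0$ and, for each $r>0$, a constant $C_r>0$ depending only on $r$, such that in the above setting, for all $p,n\ge1$ and $\tau,\delta>0$, with probability at least $1-2/p$, $$\|R\|^2\le C\Big(r^6\sum_{j=1}^p(\alpha_p^j)^2\vee r^4\sum_{j=1}^p(\beta_p^j)^2\Big),\qquad \|V_2\|_{F_p^*}^2\le C\,\frac{\lambda_{\max}(F_p^*)}{\tau^2}\Big(r^6\sum_{j=1}^p(\alpha_p^j)^2\vee r^4\sum_{j=1}^p(\beta_p^j)^2\Big),$$ $$\|V_2\|_{F_p^*}^2\le C_r\,\frac{\lambda_{\max}(F_p^*)}{\tau^2}\Big(r^6\sum_{j=1}^p(\beta_p^j)^2\vee r^4\sum_{j=1}^p(\alpha_p^j)^2\Big).$$ -/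

import Mathlib

open MeasureTheory ProbabilityTheory Set Filter Topology
open scoped ENNReal Matrix

noncomputable section

/-- `ℝᵖ` with its Euclidean norm. -/
abbrev Vec (p : ℕ) : Type := EuclideanSpace ℝ (Fin p)

/-- The partial derivative `∂_{θ_j} g`. -/
def partialD {p : ℕ} (j : Fin p) (g : Vec p → ℝ) : Vec p → ℝ :=
  fun θ => fderiv ℝ g θ (EuclideanSpace.single j 1)

/-- The gradient `∂_θ g (θ)`. -/
def gradV {p : ℕ} (g : Vec p → ℝ) (θ : Vec p) : Vec p :=
  WithLp.toLp 2 fun k => partialD k g θ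

/-- The Hessian matrix `∂_θ ∂_θᵀ g (θ)`. -/
def hessM {p : ℕ} (g : Vec p → ℝ) (θ : Vec p) : Matrix (Fin p) (Fin p) ℝ :=
  Matrix.of fun k l => partialD k (partialD l g) θ

/-- The operator norm of a matrix for the Euclidean norm. -/
def opNorm {p : ℕ} (A : Matrix (Fin p) (Fin p) ℝ) : ℝ :=
  ‖Matrix.toEuclideanCLM (n := Fin p) (𝕜 := ℝ) A‖

/-- The largest eigenvalue (used for symmetric matrices of positive size). -/
def lambdaMax {p : ℕ} (A : Matrix (Fin p) (Fin p) ℝ) : ℝ := sSup (spectrum ℝ A)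

/-- The quadratic form `bᵀ A b`, that is the squared weighted norm `‖b‖²_A`. -/
def weightedSq {p : ℕ} (A : Matrix (Fin p) (Fin p) ℝ) (b : Vec p) : ℝ :=
  b.ofLp ⬝ᵥ (A *ᵥ b.ofLp)

/-- A family of positive, thrice differentiable probability densities `f θ`, `θ ∈ Θ ⊆ ℝᵖ`,
on a sample space `Z ⊆ ℝᵈ` (with respect to Lebesgue measure). Values of `f θ z` with `z ∉ Z`
play no role. -/
structure DensityFamily (p d : ℕ) where
  /-- parameter space -/
  Θ : Set (Vec p)
  /-- sample space -/
  Z : Set (Vec d)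
  /-- `f θ z` is the density with parameter `θ` at the point `z` -/
  f : Vec p → Vec d → ℝ
  measurableSet_Z : MeasurableSet Z
  measurable_f : ∀ θ ∈ Θ, Measurable (f θ)
  pos : ∀ θ ∈ Θ, ∀ z ∈ Z, 0 < f θ z
  lintegral_eq_one : ∀ θ ∈ Θ, ∫⁻ z in Z, ENNReal.ofReal (f θ z) = 1
  /-- `θ ↦ f θ z` is thrice differentiable near each point of `Θ` -/
  smooth : ∀ z ∈ Z, ∀ θ ∈ Θ, ∀ᶠ θ' in 𝓝 θ, ∀ k < 3,
    DifferentiableAt ℝ (iteratedFDeriv ℝ k fun t => f t z) θ'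

namespace DensityFamily

variable {p d : ℕ} (m : DensityFamily p d)

/-- The law on `ℝᵈ` with density `f θ` on the sample space. -/
def law (θ : Vec p) : Measure (Vec d) :=
  (volume.restrict m.Z).withDensity fun z => ENNReal.ofReal (m.f θ z)

/-- The log-likelihood `θ ↦ log f_θ(z)` of one observation. -/
def logLik (z : Vec d) (θ : Vec p) : ℝ := Real.log (m.f θ z)

/-- The score `∂_θ log f_θ(z)`. -/
def score (θ : Vec p) (z : Vec d) : Vec p := gradV (m.logLik z) θ

/-- The Fisher information matrix `E[∂_θ log f_θ(Z) (∂_θ log f_θ(Z))ᵀ]`, where `Z` has density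
`f_θ`. -/
def fisher (θ : Vec p) : Matrix (Fin p) (Fin p) ℝ :=
  Matrix.of fun k l => ∫ z, m.score θ z k * m.score θ z l ∂(m.law θ)

/-- The empirical Fisher information matrix at `θ` of a sample `z₁, …, zₙ`. -/
def empFisher {n : ℕ} (z : Fin n → Vec d) (θ : Vec p) : Matrix (Fin p) (Fin p) ℝ :=
  Matrix.of fun k l => (n : ℝ)⁻¹ * ∑ i, m.score θ (z i) k * m.score θ (z i) l

/-- The mean negative log-likelihood `Mₙ(θ) = -n⁻¹ ∑ᵢ log f_θ(zᵢ)`. -/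
def negLogLik {n : ℕ} (z : Fin n → Vec d) (θ : Vec p) : ℝ :=
  -((n : ℝ)⁻¹ * ∑ i, m.logLik (z i) θ)

/-- `t` is a minimizer over `Θ` of the penalized loss `Mₙ(θ) + (τ/2) ‖θ‖²`. -/
def IsPenalizedMLE {n : ℕ} (z : Fin n → Vec d) (τ : ℝ) (t : Vec p) : Prop :=
  t ∈ m.Θ ∧ IsMinOn (fun θ => m.negLogLik z θ + τ / 2 * ‖θ‖ ^ 2) m.Θ t

/-- The matrix `U^j(θ, z) = ∂_{θ_j} ∂_θ ∂_θᵀ log f_θ(z)` of third derivatives. -/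
def thirdD (j : Fin p) (θ : Vec p) (z : Vec d) : Matrix (Fin p) (Fin p) ℝ :=
  Matrix.of fun k l => partialD j (fun t => hessM (m.logLik z) t k l) θ

/-- `β^j`, the supremum of `‖U^j(θ, z)‖_op` over `θ ∈ Θ` and `z` in the sample space. -/
def beta (j : Fin p) : ℝ≥0∞ :=
  ⨆ z ∈ m.Z, ⨆ θ ∈ m.Θ, ENNReal.ofReal (opNorm (m.thirdD j θ z))

/-- `α^j`, the local Lipschitz constant (at scale `δ`) of `θ ↦ U^j(θ, z)` in operator norm,
uniformly over `z` in the sample space. -/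
def alpha (δ : ℝ) (j : Fin p) : ℝ≥0∞ :=
  ⨆ z ∈ m.Z, ⨆ θ ∈ m.Θ, ⨆ θ' ∈ m.Θ, ⨆ (_ : ‖θ - θ'‖ < δ) (_ : θ ≠ θ'),
    ENNReal.ofReal (opNorm (m.thirdD j θ z - m.thirdD j θ' z) / ‖θ - θ'‖)

/-- `R` is the residual of the second order Taylor expansion at `θs` of `∂_θ Mₙ(t)`. It is either
the exact remainder `∂_θ Mₙ(t) - ∂_θ Mₙ(θs) - ∂_θ ∂_θᵀ Mₙ(θs) (t - θs)`, or given
by the quadratic forms `R_j = (t - θs)ᵀ ∂_θ ∂_θᵀ ∂_{θ_j} Mₙ(c j) (t - θs)` for some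
`c j ∈ Θ` each of whose coordinates lies between those of `t` and `θs`. (In Lagrange's
form of the exact remainder, this quadratic form carries the factor `1/2`.) -/
def IsTaylorResidual {n : ℕ} (z : Fin n → Vec d) (θs t R : Vec p) : Prop :=
  R = gradV (m.negLogLik z) t - gradV (m.negLogLik z) θs
      - WithLp.toLp 2 (hessM (m.negLogLik z) θs *ᵥ (t - θs).ofLp) ∨
  ∃ c : Fin p → Vec p, (∀ j, c j ∈ m.Θ ∧ ∀ k, c j k ∈ uIcc (t k) (θs k)) ∧
    ∀ j, R j = weightedSq (hessM (partialD j (m.negLogLik z)) (c j)) (t - θs)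

/-- The scaled Taylor residual `V₂ = (F̂ + τ I)⁻¹ R`. -/
def scaledResidual {n : ℕ} (z : Fin n → Vec d) (τ : ℝ) (θs R : Vec p) : Vec p :=
  WithLp.toLp 2 ((m.empFisher z θs + τ • (1 : Matrix (Fin p) (Fin p) ℝ))⁻¹ *ᵥ R.ofLp)

end DensityFamily

end

/-!
At every sample in the sample space, the Hessian of `∂_j Mₙ` is minus the average of the matrices
`U^j(·, zᵢ)`, because third derivatives are symmetric. Its operator norm on `Θ` is thus at most
`β^j`, and Taylor's formula along the segment from `θ*` to `t` gives `|R_j| ≤ β^j ‖t - θ*‖²`. So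
`‖R‖² ≤ ‖t - θ*‖⁴ ∑ (β^j)²` deterministically, and `‖t - θ*‖ ≤ 2r`. The bound on `V₂` follows since
`(F̂ + τ I)⁻¹` has norm at most `1/τ`.

The third derivative is not assumed to be continuous, so `ContDiffAt` is not available.
-/

section Calculus

variable {E F G : Type*} [NormedAddCommGroup E] [NormedSpace ℝ E]
  [NormedAddCommGroup F] [NormedSpace ℝ F] [NormedAddCommGroup G] [NormedSpace ℝ G]

/-- `g` is three times Fréchet differentiable at every point of a neighbourhood of `x`; no
continuity of the third derivative is required. -/
def ThriceDifferentiableNear (g : E → F) (x : E) : Prop :=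
  ∀ᶠ t in 𝓝 x, DifferentiableAt ℝ g t ∧ DifferentiableAt ℝ (fderiv ℝ g) t ∧
    DifferentiableAt ℝ (fderiv ℝ (fderiv ℝ g)) t

theorem differentiableAt_iteratedFDeriv_zero_iff {g : E → F} {x : E} :
    DifferentiableAt ℝ (iteratedFDeriv ℝ 0 g) x ↔ DifferentiableAt ℝ g x := by
  rw [iteratedFDeriv_zero_eq_comp, LinearIsometryEquiv.comp_differentiableAt_iff]

theorem differentiableAt_iteratedFDeriv_succ_iff {g : E → F} {x : E} {k : ℕ} :
    DifferentiableAt ℝ (iteratedFDeriv ℝ (k + 1) g) x ↔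
      DifferentiableAt ℝ (iteratedFDeriv ℝ k (fderiv ℝ g)) x := by
  have hcurry : iteratedFDeriv ℝ (k + 1) g =
      (continuousMultilinearCurryRightEquiv' ℝ k E F).symm ∘ iteratedFDeriv ℝ k (fderiv ℝ g) :=
    funext fun _ => iteratedFDeriv_succ_eq_comp_right
  rw [hcurry]
  exact LinearIsometryEquiv.comp_differentiableAt_iff (𝕜 := ℝ) (G := E)
    (E := ContinuousMultilinearMap ℝ (fun _ : Fin k => E) (E →L[ℝ] F))
    (F := ContinuousMultilinearMap ℝ (fun _ : Fin (k + 1) => E) F)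
    (continuousMultilinearCurryRightEquiv' ℝ k E F).symm

theorem fderiv_clm_apply_const {L : E → F →L[ℝ] G} {x : E} (hL : DifferentiableAt ℝ L x)
    (v : F) (u : E) : fderiv ℝ (fun t => L t v) x u = fderiv ℝ L x u v := by
  simp [fderiv_clm_apply hL (differentiableAt_const v)]

theorem hasDerivAt_comp_add_smul {g : E → F} {x h : E} {s : ℝ}
    (hg : DifferentiableAt ℝ g (x + s • h)) :
    HasDerivAt (fun s : ℝ => g (x + s • h)) (fderiv ℝ g (x + s • h) h) s := by
  have hline : HasDerivAt (fun s : ℝ => x + s • h) h s := by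
    simpa using ((hasDerivAt_id s).smul_const h).const_add x
  exact hg.hasFDerivAt.comp_hasDerivAt s hline

theorem norm_sub_sub_fderiv_le_of_norm_fderiv_fderiv_le {g : E → F} {x h : E} {B : ℝ}
    (hg : ∀ s ∈ Icc (0 : ℝ) 1, DifferentiableAt ℝ g (x + s • h))
    (hg' : ∀ s ∈ Icc (0 : ℝ) 1, DifferentiableAt ℝ (fderiv ℝ g) (x + s • h))
    (hB : ∀ s ∈ Icc (0 : ℝ) 1, ‖fderiv ℝ (fderiv ℝ g) (x + s • h) h h‖ ≤ B) :
    ‖g (x + h) - g x - fderiv ℝ g x h‖ ≤ B := by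
  have hfirst : ∀ s ∈ Icc (0 : ℝ) 1, HasDerivAt (fun s : ℝ => g (x + s • h))
      (fderiv ℝ g (x + s • h) h) s := fun s hs => hasDerivAt_comp_add_smul (hg s hs)
  have hsecond : ∀ s ∈ Icc (0 : ℝ) 1, HasDerivAt (fun s : ℝ => fderiv ℝ g (x + s • h) h)
      (fderiv ℝ (fderiv ℝ g) (x + s • h) h h) s := fun s hs => by
    simpa using (hasDerivAt_comp_add_smul (hg' s hs)).clm_apply (hasDerivAt_const s h)
  have hB0 : 0 ≤ B := (norm_nonneg _).trans (hB 0 (by simp))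
  have hslope : ∀ s ∈ Icc (0 : ℝ) 1, ‖fderiv ℝ g (x + s • h) h - fderiv ℝ g x h‖ ≤ B := by
    intro s hs
    have hmean := norm_image_sub_le_of_norm_deriv_le_segment'
      (fun s hs => (hsecond s hs).hasDerivWithinAt) (fun s hs => hB s (Ico_subset_Icc_self hs)) s hs
    rw [zero_smul, add_zero, sub_zero] at hmean
    exact hmean.trans (mul_le_of_le_one_right hB0 hs.2)
  have hmean := norm_image_sub_le_of_norm_deriv_le_segment_01'
    (f := fun s : ℝ => g (x + s • h) - s • fderiv ℝ g x h)
    (fun s hs => ((hfirst s hs).sub ((hasDerivAt_id s).smul_const _)).hasDerivWithinAt)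
    (fun s hs => by simpa using hslope s (Ico_subset_Icc_self hs))
  simpa [sub_right_comm] using hmean

theorem differentiableAt_const_smul_sum {ι : Type*} [Fintype ι] {g : ι → E → F} {x : E} (c : ℝ)
    (hg : ∀ i, DifferentiableAt ℝ (g i) x) : DifferentiableAt ℝ (fun t => c • ∑ i, g i t) x :=
  (DifferentiableAt.fun_sum fun i _ => hg i).const_smul c

theorem eventuallyEq_fderiv_const_smul_sum {ι : Type*} [Fintype ι] {g : ι → E → F} {x : E} (c : ℝ)
    (hg : ∀ i, ∀ᶠ t in 𝓝 x, DifferentiableAt ℝ (g i) t) :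
    fderiv ℝ (fun t => c • ∑ i, g i t) =ᶠ[𝓝 x] fun t => c • ∑ i, fderiv ℝ (g i) t := by
  filter_upwards [eventually_all.2 hg] with t ht
  exact ((HasFDerivAt.fun_sum fun i _ => (ht i).hasFDerivAt).const_smul c).fderiv

theorem eventuallyEq_fderiv_log {g : E → ℝ} {x : E} (hg : ∀ᶠ t in 𝓝 x, DifferentiableAt ℝ g t)
    (hx : ∀ᶠ t in 𝓝 x, g t ≠ 0) :
    fderiv ℝ (fun t => Real.log (g t)) =ᶠ[𝓝 x] fun t => (g t)⁻¹ • fderiv ℝ g t := by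
  filter_upwards [hg, hx] with t ht htx
  exact (ht.hasFDerivAt.log htx).fderiv

theorem fderiv_inv_smul {g : E → ℝ} {f : E → F} {x : E} (hg : DifferentiableAt ℝ g x)
    (hx : g x ≠ 0) (hf : DifferentiableAt ℝ f x) :
    fderiv ℝ (fun t => (g t)⁻¹ • f t) x =
      (g x)⁻¹ • fderiv ℝ f x +
        ContinuousLinearMap.smulRightL ℝ E F (-((g x) ^ 2)⁻¹ • fderiv ℝ g x) (f x) :=
  (((hasDerivAt_inv hx).comp_hasFDerivAt x hg.hasFDerivAt).smul hf.hasFDerivAt).fderiv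

theorem differentiableAt_smulRightL_apply {φ : E → E →L[ℝ] ℝ} {f : E → F} {x : E}
    (hφ : DifferentiableAt ℝ φ x) (hf : DifferentiableAt ℝ f x) :
    DifferentiableAt ℝ (fun t => ContinuousLinearMap.smulRightL ℝ E F (φ t) (f t)) x :=
  ((ContinuousLinearMap.smulRightL ℝ E F).differentiableAt.comp x hφ).clm_apply hf

end Calculus

namespace ThriceDifferentiableNear

variable {E F : Type*} [NormedAddCommGroup E] [NormedSpace ℝ E]
  [NormedAddCommGroup F] [NormedSpace ℝ F]

theorem of_iteratedFDeriv {g : E → F} {x : E}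
    (h : ∀ᶠ t in 𝓝 x, ∀ k < 3, DifferentiableAt ℝ (iteratedFDeriv ℝ k g) t) :
    ThriceDifferentiableNear g x := by
  filter_upwards [h] with t ht
  have h₁ := differentiableAt_iteratedFDeriv_succ_iff.1 (ht 1 (by norm_num))
  have h₂ := differentiableAt_iteratedFDeriv_succ_iff.1
    (differentiableAt_iteratedFDeriv_succ_iff.1 (ht 2 (by norm_num)))
  exact ⟨differentiableAt_iteratedFDeriv_zero_iff.1 (ht 0 (by norm_num)),
    differentiableAt_iteratedFDeriv_zero_iff.1 h₁, differentiableAt_iteratedFDeriv_zero_iff.1 h₂⟩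

theorem log {g : E → ℝ} {x : E} (h : ThriceDifferentiableNear g x) (hx : g x ≠ 0) :
    ThriceDifferentiableNear (fun t => Real.log (g t)) x := by
  have hne : ∀ᶠ t in 𝓝 x, g t ≠ 0 := h.self_of_nhds.1.continuousAt.eventually_ne hx
  have hfirst := eventuallyEq_fderiv_log (h.mono fun _ ht => ht.1) hne
  have hsecond : fderiv ℝ (fderiv ℝ fun t => Real.log (g t)) =ᶠ[𝓝 x] fun t =>
      (g t)⁻¹ • fderiv ℝ (fderiv ℝ g) t + ContinuousLinearMap.smulRightL ℝ E (E →L[ℝ] ℝ)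
        (-((g t) ^ 2)⁻¹ • fderiv ℝ g t) (fderiv ℝ g t) := by
    filter_upwards [h, hne, hfirst.fderiv (𝕜 := ℝ)] with t ⟨hg, hg', _⟩ htx hfirst_t
    exact hfirst_t.trans (fderiv_inv_smul hg htx hg')
  filter_upwards [h, hne, hfirst.eventuallyEq_nhds, hsecond.eventuallyEq_nhds]
    with t ⟨hg, hg', hg''⟩ htx hfirst_t hsecond_t
  have hsquare : DifferentiableAt ℝ (fun t => -((g t) ^ 2)⁻¹ • fderiv ℝ g t) t :=
    ((hg.pow 2).inv (pow_ne_zero 2 htx)).neg.smul hg'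
  exact ⟨hg.log htx, hfirst_t.differentiableAt_iff.2 ((hg.inv htx).smul hg'),
    hsecond_t.differentiableAt_iff.2 (((hg.inv htx).smul hg'').add
      (differentiableAt_smulRightL_apply hsquare hg'))⟩

theorem fderiv_fderiv_comm {g : E → F} {x : E} (h : ThriceDifferentiableNear g x) (u v : E) :
    fderiv ℝ (fderiv ℝ g) x u v = fderiv ℝ (fderiv ℝ g) x v u :=
  second_derivative_symmetric_of_eventually (h.mono fun _ ht => ht.1.hasFDerivAt)
    h.self_of_nhds.2.1.hasFDerivAt u v

theorem fderiv_fderiv_fderiv_comm_left {g : E → F} {x : E} (h : ThriceDifferentiableNear g x)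
    (u v w : E) :
    fderiv ℝ (fderiv ℝ (fderiv ℝ g)) x u v w = fderiv ℝ (fderiv ℝ (fderiv ℝ g)) x v u w :=
  DFunLike.congr_fun (second_derivative_symmetric_of_eventually
    (h.mono fun _ ht => ht.2.1.hasFDerivAt) h.self_of_nhds.2.2.hasFDerivAt u v) w

theorem fderiv_fderiv_fderiv_apply {g : E → F} {x : E} (h : ThriceDifferentiableNear g x)
    (u v w : E) :
    fderiv ℝ (fun t => fderiv ℝ (fderiv ℝ g) t v w) x u =
      fderiv ℝ (fderiv ℝ (fderiv ℝ g)) x u v w := by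
  have hD : DifferentiableAt ℝ (fderiv ℝ (fderiv ℝ g)) x := h.self_of_nhds.2.2
  rw [fderiv_clm_apply_const (hD.clm_apply (differentiableAt_const v)),
    fderiv_clm_apply_const hD]

theorem fderiv_fderiv_fderiv_comm_right {g : E → F} {x : E} (h : ThriceDifferentiableNear g x)
    (u v w : E) :
    fderiv ℝ (fderiv ℝ (fderiv ℝ g)) x u v w = fderiv ℝ (fderiv ℝ (fderiv ℝ g)) x u w v := by
  have hcomm : (fun t => fderiv ℝ (fderiv ℝ g) t v w) =ᶠ[𝓝 x]
      fun t => fderiv ℝ (fderiv ℝ g) t w v :=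
    (eventually_eventually_nhds.2 h).mono fun t ht => fderiv_fderiv_comm ht v w
  rw [← h.fderiv_fderiv_fderiv_apply, ← h.fderiv_fderiv_fderiv_apply, hcomm.fderiv_eq]

theorem differentiableAt_fderiv_apply {g : E → F} {x : E} (h : ThriceDifferentiableNear g x)
    (v : E) : DifferentiableAt ℝ (fun t => fderiv ℝ g t v) x :=
  h.self_of_nhds.2.1.clm_apply (differentiableAt_const v)

theorem differentiableAt_fderiv_fderiv_apply {g : E → F} {x : E}
    (h : ThriceDifferentiableNear g x) (v : E) :
    DifferentiableAt ℝ (fderiv ℝ fun t => fderiv ℝ g t v) x := by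
  have hD : (fderiv ℝ fun t => fderiv ℝ g t v) =ᶠ[𝓝 x]
      fun t => (ContinuousLinearMap.apply ℝ F v).comp (fderiv ℝ (fderiv ℝ g) t) :=
    h.mono fun t ht => ContinuousLinearMap.ext fun u => fderiv_clm_apply_const ht.2.1 v u
  exact hD.differentiableAt_iff.2 ((differentiableAt_const _).clm_comp h.self_of_nhds.2.2)

section ConstSmulSum

variable {ι : Type*} [Fintype ι] {g : ι → E → F} {x : E}

theorem eventuallyEq_fderiv_fderiv_const_smul_sum (h : ∀ i, ThriceDifferentiableNear (g i) x)
    (c : ℝ) :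
    fderiv ℝ (fderiv ℝ fun t => c • ∑ i, g i t) =ᶠ[𝓝 x]
      fun t => c • ∑ i, fderiv ℝ (fderiv ℝ (g i)) t :=
  (eventuallyEq_fderiv_const_smul_sum c fun i => (h i).mono fun _ ht => ht.1).fderiv.trans
    (eventuallyEq_fderiv_const_smul_sum c fun i => (h i).mono fun _ ht => ht.2.1)

theorem fderiv_fderiv_fderiv_const_smul_sum (h : ∀ i, ThriceDifferentiableNear (g i) x) (c : ℝ) :
    fderiv ℝ (fderiv ℝ (fderiv ℝ fun t => c • ∑ i, g i t)) x =
      c • ∑ i, fderiv ℝ (fderiv ℝ (fderiv ℝ (g i))) x := by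
  rw [(eventuallyEq_fderiv_fderiv_const_smul_sum h c).fderiv_eq]
  exact (eventuallyEq_fderiv_const_smul_sum (g := fun i => fderiv ℝ (fderiv ℝ (g i))) c
    fun i => (h i).mono fun _ ht => ht.2.2).self_of_nhds

theorem const_smul_sum (h : ∀ i, ThriceDifferentiableNear (g i) x) (c : ℝ) :
    ThriceDifferentiableNear (fun t => c • ∑ i, g i t) x := by
  have hfirst := eventuallyEq_fderiv_const_smul_sum c fun i => (h i).mono fun _ ht => ht.1
  have hsecond := eventuallyEq_fderiv_fderiv_const_smul_sum h c
  filter_upwards [eventually_all.2 h, hfirst.eventuallyEq_nhds, hsecond.eventuallyEq_nhds]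
    with t ht hfirst_t hsecond_t
  exact ⟨differentiableAt_const_smul_sum c fun i => (ht i).1,
    hfirst_t.differentiableAt_iff.2 (differentiableAt_const_smul_sum c fun i => (ht i).2.1),
    hsecond_t.differentiableAt_iff.2 (differentiableAt_const_smul_sum
      (g := fun i => fderiv ℝ (fderiv ℝ (g i))) c fun i => (ht i).2.2)⟩

end ConstSmulSum

end ThriceDifferentiableNear

section PartialDerivatives

theorem sum_clm_single_mul {ι : Type*} [Fintype ι] [DecidableEq ι]
    (φ : EuclideanSpace ℝ ι →L[ℝ] ℝ) (b : EuclideanSpace ℝ ι) :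
    ∑ i, φ (EuclideanSpace.single i 1) * b i = φ b := by
  conv_rhs => rw [← (EuclideanSpace.basisFun ι ℝ).sum_repr b]
  simp [map_sum, mul_comm]

variable {p : ℕ} {g : Vec p → ℝ} {θ : Vec p}

theorem partialD_partialD (h : DifferentiableAt ℝ (fderiv ℝ g) θ) (k l : Fin p) :
    partialD k (partialD l g) θ =
      fderiv ℝ (fderiv ℝ g) θ (EuclideanSpace.single k 1) (EuclideanSpace.single l 1) :=
  fderiv_clm_apply_const h _ _

theorem partialD_partialD_partialD (h : ThriceDifferentiableNear g θ) (j k l : Fin p) :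
    partialD j (partialD k (partialD l g)) θ =
      fderiv ℝ (fderiv ℝ (fderiv ℝ g)) θ (EuclideanSpace.single j 1)
        (EuclideanSpace.single k 1) (EuclideanSpace.single l 1) := by
  have hkl : partialD k (partialD l g) =ᶠ[𝓝 θ] fun t =>
      fderiv ℝ (fderiv ℝ g) t (EuclideanSpace.single k 1) (EuclideanSpace.single l 1) :=
    h.mono fun t ht => partialD_partialD ht.2.1 k l
  rw [← h.fderiv_fderiv_fderiv_apply, ← hkl.fderiv_eq, partialD]

theorem weightedSq_hessM (h : DifferentiableAt ℝ (fderiv ℝ g) θ) (b : Vec p) :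
    weightedSq (hessM g θ) b = fderiv ℝ (fderiv ℝ g) θ b b := by
  rw [← (fderiv ℝ (fderiv ℝ g) θ).flip_apply b b, ← sum_clm_single_mul]
  simp only [weightedSq, dotProduct, Matrix.mulVec, hessM, Matrix.of_apply, partialD_partialD h,
    ContinuousLinearMap.flip_apply]
  exact Finset.sum_congr rfl fun k _ => by rw [sum_clm_single_mul, mul_comm]

theorem hessM_mulVec_apply (h : ThriceDifferentiableNear g θ) (b : Vec p) (j : Fin p) :
    (hessM g θ *ᵥ b.ofLp) j = fderiv ℝ (partialD j g) θ b := by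
  have hD : DifferentiableAt ℝ (fderiv ℝ g) θ := h.self_of_nhds.2.1
  calc (hessM g θ *ᵥ b.ofLp) j
      = fderiv ℝ (fderiv ℝ g) θ (EuclideanSpace.single j 1) b := by
        rw [← sum_clm_single_mul]
        simp only [Matrix.mulVec, dotProduct, hessM, Matrix.of_apply, partialD_partialD hD]
    _ = fderiv ℝ (fderiv ℝ g) θ b (EuclideanSpace.single j 1) := h.fderiv_fderiv_comm _ _
    _ = fderiv ℝ (partialD j g) θ b := (fderiv_clm_apply_const hD _ _).symm

theorem hessM_partialD (h : ThriceDifferentiableNear g θ) (j : Fin p) :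
    hessM (partialD j g) θ = Matrix.of fun k l => partialD j (fun t => hessM g t k l) θ := by
  ext k l
  calc hessM (partialD j g) θ k l
      = fderiv ℝ (fderiv ℝ (fderiv ℝ g)) θ (EuclideanSpace.single k 1)
          (EuclideanSpace.single l 1) (EuclideanSpace.single j 1) :=
        partialD_partialD_partialD h k l j
    _ = fderiv ℝ (fderiv ℝ (fderiv ℝ g)) θ (EuclideanSpace.single j 1)
          (EuclideanSpace.single k 1) (EuclideanSpace.single l 1) := by
        rw [h.fderiv_fderiv_fderiv_comm_right, h.fderiv_fderiv_fderiv_comm_left]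
    _ = partialD j (fun t => hessM g t k l) θ := (partialD_partialD_partialD h j k l).symm

theorem hessM_partialD_const_smul_sum {ι : Type*} [Fintype ι] {g : ι → Vec p → ℝ}
    (h : ∀ i, ThriceDifferentiableNear (g i) θ) (c : ℝ) (j : Fin p) :
    hessM (partialD j fun t => c • ∑ i, g i t) θ = c • ∑ i, hessM (partialD j (g i)) θ := by
  ext k l
  simp only [hessM, Matrix.of_apply, Matrix.smul_apply, Matrix.sum_apply,
    partialD_partialD_partialD (ThriceDifferentiableNear.const_smul_sum h c),
    partialD_partialD_partialD (h _),
    ThriceDifferentiableNear.fderiv_fderiv_fderiv_const_smul_sum h]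
  simp

theorem abs_partialD_sub_sub_hessM_le {h : Vec p} {B : ℝ} (j : Fin p)
    (hg : ∀ s ∈ Icc (0 : ℝ) 1, ThriceDifferentiableNear g (θ + s • h))
    (hB : ∀ s ∈ Icc (0 : ℝ) 1, |weightedSq (hessM (partialD j g) (θ + s • h)) h| ≤ B) :
    |partialD j g (θ + h) - partialD j g θ - (hessM g θ *ᵥ h.ofLp) j| ≤ B := by
  rw [hessM_mulVec_apply (by simpa using hg 0 (by simp))]
  refine norm_sub_sub_fderiv_le_of_norm_fderiv_fderiv_le
    (fun s hs => (hg s hs).differentiableAt_fderiv_apply _)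
    (fun s hs => (hg s hs).differentiableAt_fderiv_fderiv_apply _) fun s hs => ?_
  have hweighted := weightedSq_hessM (g := partialD j g)
    ((hg s hs).differentiableAt_fderiv_fderiv_apply _) h
  exact hweighted ▸ hB s hs

end PartialDerivatives

section Matrices

theorem dotProduct_ofLp_self {ι : Type*} [Fintype ι] (b : EuclideanSpace ℝ ι) :
    b.ofLp ⬝ᵥ b.ofLp = ‖b‖ ^ 2 := by
  simp [EuclideanSpace.real_norm_sq_eq, dotProduct, ← sq]

theorem mul_norm_inv_add_smul_one_mulVec_le {ι : Type*} [Fintype ι] [DecidableEq ι]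
    {A : Matrix ι ι ℝ} (hA : A.PosSemidef) {τ : ℝ} (hτ : 0 < τ) (b : EuclideanSpace ℝ ι) :
    τ * ‖WithLp.toLp 2 ((A + τ • (1 : Matrix ι ι ℝ))⁻¹ *ᵥ b.ofLp)‖ ≤ ‖b‖ := by
  set v : EuclideanSpace ℝ ι := WithLp.toLp 2 ((A + τ • (1 : Matrix ι ι ℝ))⁻¹ *ᵥ b.ofLp) with hv
  have hdet : IsUnit (A + τ • (1 : Matrix ι ι ℝ)).det :=
    (Matrix.isUnit_iff_isUnit_det _).1
      (Matrix.PosDef.posSemidef_add hA (Matrix.PosDef.one.smul hτ)).isUnit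
  have hb : (A + τ • (1 : Matrix ι ι ℝ)) *ᵥ v.ofLp = b.ofLp := by
    rw [hv, Matrix.mulVec_mulVec, Matrix.mul_nonsing_inv _ hdet, Matrix.one_mulVec]
  have hcoercive : τ * ‖v‖ ^ 2 ≤ ‖v‖ * ‖b‖ := by
    calc τ * ‖v‖ ^ 2
        ≤ v.ofLp ⬝ᵥ (A *ᵥ v.ofLp) + τ * ‖v‖ ^ 2 :=
          le_add_of_nonneg_left (by simpa using hA.dotProduct_mulVec_nonneg v.ofLp)
      _ = v.ofLp ⬝ᵥ b.ofLp := by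
          rw [← hb, Matrix.add_mulVec, Matrix.smul_mulVec, Matrix.one_mulVec, dotProduct_add,
            dotProduct_smul, dotProduct_ofLp_self, smul_eq_mul]
      _ = inner ℝ b v := by rw [EuclideanSpace.inner_eq_star_dotProduct, star_trivial]
      _ ≤ ‖v‖ * ‖b‖ := (real_inner_le_norm b v).trans_eq (mul_comm _ _)
  rcases (norm_nonneg v).eq_or_lt with hv0 | hv0
  · rw [← hv0, mul_zero]
    exact norm_nonneg b
  · exact le_of_mul_le_mul_left (by linarith) hv0

variable {p : ℕ}

theorem abs_weightedSq_le_opNorm_mul (A : Matrix (Fin p) (Fin p) ℝ) (b : Vec p) :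
    |weightedSq A b| ≤ opNorm A * ‖b‖ ^ 2 := by
  calc |weightedSq A b|
      = |inner ℝ b (Matrix.toEuclideanCLM (n := Fin p) (𝕜 := ℝ) A b)| := by
        rw [Matrix.inner_toEuclideanCLM, weightedSq]
    _ ≤ ‖b‖ * ‖Matrix.toEuclideanCLM (n := Fin p) (𝕜 := ℝ) A b‖ := abs_real_inner_le_norm _ _
    _ ≤ ‖b‖ * (opNorm A * ‖b‖) := by gcongr; exact ContinuousLinearMap.le_opNorm _ _
    _ = opNorm A * ‖b‖ ^ 2 := by ring

theorem opNorm_smul_sum_le {ι : Type*} [Fintype ι] (c : ℝ) (A : ι → Matrix (Fin p) (Fin p) ℝ) :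
    opNorm (c • ∑ i, A i) ≤ |c| * ∑ i, opNorm (A i) := by
  rw [opNorm, map_smul, map_sum, norm_smul, Real.norm_eq_abs]
  gcongr
  exact norm_sum_le _ _

open scoped MatrixOrder in
theorem weightedSq_le_lambdaMax_mul {A : Matrix (Fin p) (Fin p) ℝ} (hA : A.IsHermitian)
    (b : Vec p) : weightedSq A b ≤ lambdaMax A * ‖b‖ ^ 2 := by
  have hbdd : BddAbove (spectrum ℝ A) := (Matrix.finite_real_spectrum (A := A)).bddAbove
  have hle : A ≤ algebraMap ℝ (Matrix (Fin p) (Fin p) ℝ) (lambdaMax A) :=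
    le_algebraMap_of_spectrum_le (fun _ ha => le_csSup hbdd ha) hA
  have hnonneg := (Matrix.le_iff.1 hle).dotProduct_mulVec_nonneg b.ofLp
  rw [Algebra.algebraMap_eq_smul_one, Matrix.sub_mulVec, Matrix.smul_mulVec, Matrix.one_mulVec,
    dotProduct_sub, dotProduct_smul, star_trivial, dotProduct_ofLp_self, smul_eq_mul] at hnonneg
  exact sub_nonneg.1 hnonneg

end Matrices

namespace DensityFamily

variable {p d n : ℕ} (m : DensityFamily p d) {z : Fin n → Vec d} {θ t R : Vec p}

theorem ae_mem_Z (θ : Vec p) : ∀ᵐ x ∂m.law θ, x ∈ m.Z :=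
  (withDensity_absolutelyContinuous _ _).ae_le (ae_restrict_mem m.measurableSet_Z)

theorem ae_forall_mem_Z_of_map_absolutelyContinuous {Ω ι : Type*} [MeasurableSpace Ω]
    [Countable ι] {P : Measure Ω} {z : ι → Ω → Vec d} (hz : ∀ i, AEMeasurable (z i) P)
    (hlaw : ∀ i, P.map (z i) ≪ m.law θ) : ∀ᵐ ω ∂P, ∀ i, z i ω ∈ m.Z :=
  ae_all_iff.2 fun i => ae_of_ae_map (hz i) ((hlaw i).ae_le (m.ae_mem_Z θ))

theorem isHermitian_fisher (θ : Vec p) : (m.fisher θ).IsHermitian := by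
  ext k l
  simp [fisher, mul_comm]

theorem posSemidef_empFisher (z : Fin n → Vec d) (θ : Vec p) : (m.empFisher z θ).PosSemidef := by
  have hsum : m.empFisher z θ = (n : ℝ)⁻¹ • ∑ i,
      Matrix.vecMulVec (m.score θ (z i)).ofLp (star (m.score θ (z i)).ofLp) := by
    ext k l
    simp [empFisher, Matrix.sum_apply, Matrix.vecMulVec_apply]
  rw [hsum]
  exact (Matrix.posSemidef_sum _ fun i _ => Matrix.posSemidef_vecMulVec_self_star _).smul
    (by positivity)

theorem weightedSq_scaledResidual_le (z : Fin n → Vec d) {τ : ℝ} (hτ : 0 < τ) (θ R : Vec p) :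
    ENNReal.ofReal (weightedSq (m.fisher θ) (m.scaledResidual z τ θ R)) ≤
      ENNReal.ofReal (lambdaMax (m.fisher θ) / τ ^ 2) * ENNReal.ofReal (‖R‖ ^ 2) := by
  set V := m.scaledResidual z τ θ R
  have hV : τ * ‖V‖ ≤ ‖R‖ :=
    mul_norm_inv_add_smul_one_mulVec_le (m.posSemidef_empFisher z θ) hτ R
  calc ENNReal.ofReal (weightedSq (m.fisher θ) V)
      ≤ ENNReal.ofReal (lambdaMax (m.fisher θ) * ‖V‖ ^ 2) :=
        ENNReal.ofReal_le_ofReal (weightedSq_le_lambdaMax_mul (m.isHermitian_fisher θ) V)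
    _ = ENNReal.ofReal (lambdaMax (m.fisher θ) / τ ^ 2 * (τ * ‖V‖) ^ 2) := by
        congr 1
        field_simp
    _ = ENNReal.ofReal (lambdaMax (m.fisher θ) / τ ^ 2) * ENNReal.ofReal ((τ * ‖V‖) ^ 2) :=
        ENNReal.ofReal_mul' (sq_nonneg _)
    _ ≤ ENNReal.ofReal (lambdaMax (m.fisher θ) / τ ^ 2) * ENNReal.ofReal (‖R‖ ^ 2) := by gcongr

theorem thriceDifferentiableNear_logLik {z : Vec d} (hz : z ∈ m.Z) (hθ : θ ∈ m.Θ) :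
    ThriceDifferentiableNear (m.logLik z) θ :=
  (ThriceDifferentiableNear.of_iteratedFDeriv (m.smooth z hz θ hθ)).log (m.pos θ hθ z hz).ne'

theorem negLogLik_eq_smul_sum (z : Fin n → Vec d) :
    m.negLogLik z = fun θ => (-(n : ℝ)⁻¹) • ∑ i, m.logLik (z i) θ := by
  ext θ
  simp [negLogLik]

theorem thriceDifferentiableNear_negLogLik (hz : ∀ i, z i ∈ m.Z) (hθ : θ ∈ m.Θ) :
    ThriceDifferentiableNear (m.negLogLik z) θ := by
  rw [negLogLik_eq_smul_sum]
  exact .const_smul_sum (fun i => m.thriceDifferentiableNear_logLik (hz i) hθ) _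

theorem hessM_partialD_negLogLik (hz : ∀ i, z i ∈ m.Z) (hθ : θ ∈ m.Θ) (j : Fin p) :
    hessM (partialD j (m.negLogLik z)) θ = (-(n : ℝ)⁻¹) • ∑ i, m.thirdD j θ (z i) := by
  have hlog i := m.thriceDifferentiableNear_logLik (hz i) hθ
  rw [negLogLik_eq_smul_sum, hessM_partialD_const_smul_sum hlog]
  simp only [hessM_partialD (hlog _), thirdD]

theorem ofReal_opNorm_thirdD_le_beta {z : Vec d} (hz : z ∈ m.Z) (hθ : θ ∈ m.Θ) (j : Fin p) :
    ENNReal.ofReal (opNorm (m.thirdD j θ z)) ≤ m.beta j :=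
  le_iSup₂_of_le z hz <|
    le_iSup₂ (f := fun θ (_ : θ ∈ m.Θ) => ENNReal.ofReal (opNorm (m.thirdD j θ z))) θ hθ

theorem opNorm_hessM_partialD_negLogLik_le (hn : 1 ≤ n) (hz : ∀ i, z i ∈ m.Z) (hθ : θ ∈ m.Θ)
    {j : Fin p} (hβ : m.beta j ≠ ∞) :
    opNorm (hessM (partialD j (m.negLogLik z)) θ) ≤ (m.beta j).toReal := by
  have hn_pos : (0 : ℝ) < n := by exact_mod_cast hn
  have hthird : ∀ i, opNorm (m.thirdD j θ (z i)) ≤ (m.beta j).toReal := fun i =>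
    (ENNReal.ofReal_le_iff_le_toReal hβ).1 (m.ofReal_opNorm_thirdD_le_beta (hz i) hθ j)
  calc opNorm (hessM (partialD j (m.negLogLik z)) θ)
      ≤ |-(n : ℝ)⁻¹| * ∑ i, opNorm (m.thirdD j θ (z i)) := by
        rw [m.hessM_partialD_negLogLik hz hθ]
        exact opNorm_smul_sum_le _ _
    _ ≤ |-(n : ℝ)⁻¹| * ∑ _i : Fin n, (m.beta j).toReal := by
        gcongr with i
        exact hthird i
    _ = (m.beta j).toReal := by
        rw [abs_neg, abs_of_pos (inv_pos.2 hn_pos), Finset.sum_const, Finset.card_univ,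
          Fintype.card_fin, nsmul_eq_mul, inv_mul_cancel_left₀ hn_pos.ne']

theorem abs_weightedSq_hessM_partialD_negLogLik_le (hn : 1 ≤ n) (hz : ∀ i, z i ∈ m.Z)
    (hθ : θ ∈ m.Θ) {j : Fin p} (hβ : m.beta j ≠ ∞) (b : Vec p) :
    |weightedSq (hessM (partialD j (m.negLogLik z)) θ) b| ≤ (m.beta j).toReal * ‖b‖ ^ 2 := by
  refine (abs_weightedSq_le_opNorm_mul _ b).trans ?_
  gcongr
  exact m.opNorm_hessM_partialD_negLogLik_le hn hz hθ hβ

theorem abs_taylorResidual_apply_le (hn : 1 ≤ n) (hz : ∀ i, z i ∈ m.Z)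
    (hstar : StarConvex ℝ θ m.Θ) (ht : t ∈ m.Θ) (hR : m.IsTaylorResidual z θ t R) {j : Fin p}
    (hβ : m.beta j ≠ ∞) : |R j| ≤ (m.beta j).toReal * ‖t - θ‖ ^ 2 := by
  rcases hR with rfl | ⟨c, hc, hR⟩
  · have hsegment : ∀ s ∈ Icc (0 : ℝ) 1, θ + s • (t - θ) ∈ m.Θ := fun s hs =>
      hstar.add_smul_sub_mem ht hs.1 hs.2
    have htaylor := abs_partialD_sub_sub_hessM_le j
      (fun s hs => m.thriceDifferentiableNear_negLogLik hz (hsegment s hs))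
      (fun s hs => m.abs_weightedSq_hessM_partialD_negLogLik_le hn hz (hsegment s hs) hβ _)
    rwa [add_sub_cancel] at htaylor
  · rw [hR]
    exact m.abs_weightedSq_hessM_partialD_negLogLik_le hn hz (hc j).1 hβ _

theorem IsTaylorResidual.eq_zero (hR : m.IsTaylorResidual z θ θ R) : R = 0 := by
  rcases hR with rfl | ⟨c, -, hR⟩
  · simp
  · ext j
    simp [hR, weightedSq]

theorem ofReal_abs_taylorResidual_apply_le (hn : 1 ≤ n) (hz : ∀ i, z i ∈ m.Z)
    (hstar : StarConvex ℝ θ m.Θ) (ht : t ∈ m.Θ) (hR : m.IsTaylorResidual z θ t R) (j : Fin p) :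
    ENNReal.ofReal |R j| ≤ ENNReal.ofReal (‖t - θ‖ ^ 2) * m.beta j := by
  rcases eq_or_ne t θ with rfl | hne
  · simp [hR.eq_zero]
  by_cases hβ : m.beta j = ∞
  · have hpos : 0 < ‖t - θ‖ := norm_sub_pos_iff.2 hne
    rw [hβ, ENNReal.mul_top (ENNReal.ofReal_pos.2 (by positivity)).ne']
    exact le_top
  · rw [← ENNReal.ofReal_toReal hβ, ← ENNReal.ofReal_mul (sq_nonneg _), mul_comm]
    exact ENNReal.ofReal_le_ofReal (m.abs_taylorResidual_apply_le hn hz hstar ht hR hβ)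

theorem ofReal_norm_sq_taylorResidual_le (hn : 1 ≤ n) (hz : ∀ i, z i ∈ m.Z)
    (hstar : StarConvex ℝ θ m.Θ) (ht : t ∈ m.Θ) (hR : m.IsTaylorResidual z θ t R) :
    ENNReal.ofReal (‖R‖ ^ 2) ≤ ENNReal.ofReal (‖t - θ‖ ^ 4) * ∑ j, m.beta j ^ 2 := by
  calc ENNReal.ofReal (‖R‖ ^ 2)
      = ∑ j, ENNReal.ofReal |R j| ^ 2 := by
        rw [EuclideanSpace.real_norm_sq_eq, ENNReal.ofReal_sum_of_nonneg fun j _ => sq_nonneg _]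
        simp only [← ENNReal.ofReal_pow (abs_nonneg _), sq_abs]
    _ ≤ ∑ j, (ENNReal.ofReal (‖t - θ‖ ^ 2) * m.beta j) ^ 2 := by
        gcongr with j
        exact m.ofReal_abs_taylorResidual_apply_le hn hz hstar ht hR j
    _ = ENNReal.ofReal (‖t - θ‖ ^ 4) * ∑ j, m.beta j ^ 2 := by
        simp only [mul_pow, ← Finset.mul_sum, ← ENNReal.ofReal_pow (sq_nonneg _), ← pow_mul]

end DensityFamily

theorem norm_sub_pow_four_le {E : Type*} [SeminormedAddCommGroup E] {x y : E} {r : ℝ}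
    (hx : x ∈ Metric.closedBall 0 r) (hy : y ∈ Metric.closedBall 0 r) :
    ‖x - y‖ ^ 4 ≤ 16 * r ^ 4 := by
  have hdist : ‖x - y‖ ≤ 2 * r := by
    linarith [norm_sub_le x y, mem_closedBall_zero_iff.1 hx, mem_closedBall_zero_iff.1 hy]
  calc ‖x - y‖ ^ 4 ≤ (2 * r) ^ 4 := by gcongr
    _ = 16 * r ^ 4 := by ring

theorem ofReal_mul_le_ofReal_mul_max {a c s : ℝ} {u v : ℝ≥0∞} (hc : 0 ≤ c) (h : a ≤ c * s) :
    ENNReal.ofReal a * u ≤ ENNReal.ofReal c * max (ENNReal.ofReal s * u) v := by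
  calc ENNReal.ofReal a * u
      ≤ ENNReal.ofReal (c * s) * u := by gcongr
    _ = ENNReal.ofReal c * (ENNReal.ofReal s * u) := by rw [ENNReal.ofReal_mul hc, mul_assoc]
    _ ≤ ENNReal.ofReal c * max (ENNReal.ofReal s * u) v := by
        gcongr
        exact le_max_left _ _

theorem le_ofReal_mul_mul_of_le {c κ : ℝ} {u v w : ℝ≥0∞} (hc : 0 ≤ c)
    (hu : u ≤ ENNReal.ofReal κ * v) (hv : v ≤ ENNReal.ofReal c * w) :
    u ≤ ENNReal.ofReal (c * κ) * w := by
  calc u ≤ ENNReal.ofReal κ * (ENNReal.ofReal c * w) := hu.trans (by gcongr)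
    _ = ENNReal.ofReal (c * κ) * w := by rw [ENNReal.ofReal_mul hc]; ring

theorem mainTheorem10_general {p n d : ℕ} (hn : 1 ≤ n) (m : DensityFamily p d) {θs : Vec p}
    {τ : ℝ} (hτ : 0 < τ) (hstar : StarConvex ℝ θs m.Θ) {Ω : Type*} [MeasurableSpace Ω]
    {P : Measure Ω} {z : Fin n → Ω → Vec d} (hz : ∀ i, AEMeasurable (z i) P)
    (hlaw : ∀ i, P.map (z i) ≪ m.law θs) :
    ∀ᵐ ω ∂P, ∀ t ∈ m.Θ, ∀ R : Vec p, m.IsTaylorResidual (fun i => z i ω) θs t R →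
      ENNReal.ofReal (‖R‖ ^ 2) ≤ ENNReal.ofReal (‖t - θs‖ ^ 4) * ∑ j, m.beta j ^ 2 ∧
        ENNReal.ofReal (weightedSq (m.fisher θs) (m.scaledResidual (fun i => z i ω) τ θs R)) ≤
          ENNReal.ofReal (lambdaMax (m.fisher θs) / τ ^ 2) *
            (ENNReal.ofReal (‖t - θs‖ ^ 4) * ∑ j, m.beta j ^ 2) := by
  filter_upwards [m.ae_forall_mem_Z_of_map_absolutelyContinuous hz hlaw] with ω hzω t ht R hR
  have hnorm := m.ofReal_norm_sq_taylorResidual_le hn hzω hstar ht hR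
  exact ⟨hnorm, (m.weightedSq_scaledResidual_le _ hτ θs R).trans (by gcongr)⟩

theorem mainTheorem10 :
    ∃ C : ℝ, 0 < C ∧ ∀ r : ℝ, 0 < r → ∃ Cr : ℝ, 0 < Cr ∧
      ∀ (p n d : ℕ), 1 ≤ p → 1 ≤ n →
      ∀ (m : DensityFamily p d) (θs : Vec p) (δ τ : ℝ), 0 < δ → 0 < τ →
        m.Θ ⊆ Metric.closedBall 0 r → θs ∈ m.Θ → StarConvex ℝ θs m.Θ →
        (∀ k, MemLp (fun z => m.score θs z k) 2 (m.law θs)) →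
      ∀ (Ω : Type*) [MeasurableSpace Ω] (P : Measure Ω) [IsProbabilityMeasure P]
        (z : Fin n → Ω → Vec d) (θhat : Ω → Vec p),
        (∀ i, Measurable (z i)) → iIndepFun z P → (∀ i, P.map (z i) = m.law θs) →
        (∀ᵐ ω ∂P, m.IsPenalizedMLE (fun i => z i ω) τ (θhat ω)) →
      ∃ E : Set Ω, MeasurableSet E ∧ ENNReal.ofReal (1 - 2 / (p : ℝ)) ≤ P E ∧
        ∀ ω ∈ E, ∀ R : Vec p, m.IsTaylorResidual (fun i => z i ω) θs (θhat ω) R →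
          ENNReal.ofReal (‖R‖ ^ 2) ≤ ENNReal.ofReal C *
            max (ENNReal.ofReal (r ^ 6) * ∑ j, m.alpha δ j ^ 2)
              (ENNReal.ofReal (r ^ 4) * ∑ j, m.beta j ^ 2) ∧
          ENNReal.ofReal (weightedSq (m.fisher θs)
              (m.scaledResidual (fun i => z i ω) τ θs R)) ≤
            ENNReal.ofReal (C * (lambdaMax (m.fisher θs) / τ ^ 2)) *
              max (ENNReal.ofReal (r ^ 6) * ∑ j, m.alpha δ j ^ 2)
                (ENNReal.ofReal (r ^ 4) * ∑ j, m.beta j ^ 2) ∧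
          ENNReal.ofReal (weightedSq (m.fisher θs)
              (m.scaledResidual (fun i => z i ω) τ θs R)) ≤
            ENNReal.ofReal (Cr * (lambdaMax (m.fisher θs) / τ ^ 2)) *
              max (ENNReal.ofReal (r ^ 6) * ∑ j, m.beta j ^ 2)
                (ENNReal.ofReal (r ^ 4) * ∑ j, m.alpha δ j ^ 2) := by
  refine ⟨16, by norm_num, fun r hr => ⟨16 / r ^ 2, by positivity, ?_⟩⟩
  intro p n d _ hn m θs δ τ _ hτ hΘ hθs hstar _ Ω _ P _ z θhat hz _ hlaw hmle
  have hbound := mainTheorem10_general hn m hτ hstar (fun i => (hz i).aemeasurable)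
    fun i => (hlaw i).absolutelyContinuous
  obtain ⟨E, hE, hEm, hEω⟩ := (hbound.and hmle).exists_measurable_mem
  refine ⟨E, hEm, ?_, fun ω hω R hR => ?_⟩
  · rw [(mem_ae_iff_prob_eq_one hEm).1 hE, ENNReal.ofReal_le_one, sub_le_self_iff]
    positivity
  obtain ⟨hboundω, hθω, -⟩ := hEω ω hω
  obtain ⟨hnormR, hnormV⟩ := hboundω _ hθω R hR
  have hdist : ‖θhat ω - θs‖ ^ 4 ≤ 16 * r ^ 4 := norm_sub_pow_four_le (hΘ hθω) (hΘ hθs)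
  have hdist' : ‖θhat ω - θs‖ ^ 4 ≤ 16 / r ^ 2 * r ^ 6 := hdist.trans_eq (by field_simp)
  have hmax {α : ℝ≥0∞} := max_comm _ α ▸
    ofReal_mul_le_ofReal_mul_max (u := ∑ j, m.beta j ^ 2) (v := α) (by norm_num) hdist
  exact ⟨hnormR.trans hmax, le_ofReal_mul_mul_of_le (by norm_num) hnormV hmax,
    le_ofReal_mul_mul_of_le (by positivity) hnormV
      (ofReal_mul_le_ofReal_mul_max (by positivity) hdist')⟩
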